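/- Let $n\ge 0$. A (rooted) generalized non-crossing tree (GNC-tree) on $n+1$ vertices is a tree whose vertices are $n+1$ points $p_0,\dots,p_n$ placed in counterclockwise order on a circle, whose edges are chords no two of which cross, together with positive integer labels on the points that are weakly increasing along $p_0,\dots,p_n$ and such that whenever $j$ is a label, every $i$ with $1\le i\le j$ is also a label; the root is $p_0$ (the first point with label $1$). An edge $(v,w)$, where $v$ is on the path from the root to $w$, is an ascent ($u$), a level ($h$) or a descent ($d$) according as the label of $v$ is less than, equal to, or greater than the label of $w$; thus every path leading away from the root, starting at any vertex, is encoded by a word on $\{u,h,d\}$. A GNC-tree avoids a word $\sigma$ if no path leading away from the root is encoded by $\sigma$. For a set $P$ of words let $\mathsf{GNC}_n(P)$ be the set of GNC-trees on $n+1$ vertices that avoid every word in $P$. Let $R_n$ be the $n$th little Schröder number, $\sum_{n\ge 0}R_nt^n=\frac{1+t-\sqrt{1-6t+t^2}}{4t}$ (so $R_0,R_1,R_2,\dots=1,1,3,11,45,\dots$), and let $C_i=\frac{1}{i+1}\binom{2i}{i}$ be the Catalan numbers. Then for every $n\ge 0$ $$|\mathsf{GNC}_n(ud,h)|=R_n$$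 and $$|\mathsf{GNC}_n(du,h)|=\sum_{i+j+k=n}(-1)^k\binom{3i+2j+k}{k}\frac{i}{2j+i}\binom{2j+i}{j}2^{i+j}C_i,$$ where the sum is over triples of non-negative integers and $\frac{i}{2j+i}$ is read as $1$ when $i=j=0$. -/

import Mathlib

/-- The three kinds of edges of a rooted labelled tree, read away from the root:
ascent `u`, level `h`, descent `d`. -/
inductive GNCStep : Type
  | u
  | h
  | d
  deriving DecidableEq

/-- The kind of an edge whose endpoint nearer to the root has label `a` and whose other endpoint
has label `b`. -/
def GNCStep.ofLabels (a b : ℕ) : GNCStep :=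
  if a < b then GNCStep.u else if a = b then GNCStep.h else GNCStep.d

/-- Rooted generalized non-crossing trees with `n + 1` vertices. The points on the circle are
`0, 1, …, n` in counterclockwise order, the root being `0`, the first point with label `1`. -/
@[ext]
structure GNCTree (n : ℕ) where
  /-- the underlying graph on the points of the circle -/
  graph : SimpleGraph (Fin (n + 1))
  /-- the label of each point -/
  label : Fin (n + 1) → ℕ
  isTree : graph.IsTree
  /-- two chords cross exactly when their endpoints alternate around the circle -/
  nonCrossing : ∀ a b c e : Fin (n + 1), a < b → b < c → c < e →
    graph.Adj a c → ¬ graph.Adj b e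
  one_le_label : ∀ v, 1 ≤ label v
  label_mono : Monotone label
  /-- if `j` is a label, then so are all `1 ≤ i ≤ j` -/
  exists_label_eq : ∀ v, ∀ i, 1 ≤ i → i ≤ label v → ∃ w, label w = i

namespace GNCTree

variable {n : ℕ}

/-- `v` and `w` are joined by an edge, and `v` is on the path from the root to `w`. -/
def IsChild (T : GNCTree n) (v w : Fin (n + 1)) : Prop :=
  T.graph.Adj v w ∧ ∃ p : T.graph.Walk 0 w, p.IsPath ∧ v ∈ p.support

/-- The ternary word encoding a path, given by the list of its vertices. -/
def word (T : GNCTree n) : List (Fin (n + 1)) → List GNCStep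
  | v :: w :: l => GNCStep.ofLabels (T.label v) (T.label w) :: word T (w :: l)
  | _ => []

/-- Some path leading away from the root (starting at any vertex) is encoded by `σ`. -/
def Contains (T : GNCTree n) (σ : List GNCStep) : Prop :=
  ∃ l : List (Fin (n + 1)), l.IsChain T.IsChild ∧ T.word l = σ

/-- The GNC-trees with `n + 1` vertices that avoid every pattern in `P`. -/
def avoiding (n : ℕ) (P : Set (List GNCStep)) : Set (GNCTree n) :=
  {T | ∀ σ ∈ P, ¬ T.Contains σ}

theorem label_le (T : GNCTree n) (v : Fin (n + 1)) : T.label v ≤ n + 1 := by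
  have hsub : Finset.Icc 1 (T.label v) ⊆ Finset.univ.image T.label := by
    intro i hi
    rw [Finset.mem_Icc] at hi
    obtain ⟨w, hw⟩ := T.exists_label_eq v i hi.1 hi.2
    exact Finset.mem_image.mpr ⟨w, Finset.mem_univ _, hw⟩
  have h1 := (Finset.card_le_card hsub).trans Finset.card_image_le
  simpa using h1

/-- There are finitely many GNC-trees with `n + 1` vertices, so that cardinalities of sets of
such trees are natural numbers. -/
instance instFinite (n : ℕ) : Finite (GNCTree n) := by
  refine Finite.of_injective
    (fun T : GNCTree n => (T.graph, fun v => (⟨T.label v, Nat.lt_succ_of_le (T.label_le v)⟩ :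
      Fin (n + 1 + 1)))) ?_
  intro S T hST
  rw [Prod.mk.injEq] at hST
  refine GNCTree.ext hST.1 (funext fun v => ?_)
  exact congrArg Fin.val (congrFun hST.2 v)

end GNCTree

/-- The `n`th little Schröder number `1, 1, 3, 11, 45, 197, …` (starting at `n = 0`), with
generating function `(1 + t - √(1 - 6 t + t ^ 2)) / (4 t)`. Mathlib's sequence
`Nat.smallSchroder` is `1, 1, 1, 3, 11, 45, …`, that is, the same with the initial `1` doubled. -/
def littleSchroder (n : ℕ) : ℕ := Nat.smallSchroder (n + 1)

/-- The factor `i / (2 j + i)`, read as `1` for `i = j = 0`, so that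
`gncRatio i j * (2 * j + i).choose j` is the coefficient of `t ^ j` in the `i`th power of the
generating function of the Catalan numbers. -/
def gncRatio (i j : ℕ) : ℚ :=
  if i = 0 ∧ j = 0 then 1 else (i : ℚ) / (2 * (j : ℚ) + (i : ℚ))

/-! A weakly increasing labelling without missing labels amounts to the set `B` of gaps at which the
label goes up by one, and a rooted tree amounts to its parent function `p`. Avoiding `h` means that
every chord spans a gap of `B`; ascents are then the edges going right and descents those going
left. Given this, avoiding `du` says that left edges are followed by left edges only, and avoiding
`ud` excludes left edges altogether: the rightmost vertex reached by a left edge would have a parent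
reached by a right edge. So both families become sets of pairs `(p, B)`, described by `IsParentFn`.

Such a tree on `a, …, b` with `a < b` splits uniquely (`card_parentFns_succ`). Let `c` be the last
child of the root `a`, and `m` the last point before `c` that is `a` or is reached by a right edge.
The blocks `[a, m]` and `[c, b]` carry trees of the same kind, rooted at `a` and `c`, and `[m + 1,
c]` carries a tree rooted at `c` with left edges only. Gap `m` may or may not be in `B`, except that
it must be when `m = a` and `c = m + 1`, as the chord `{a, c}` then spans no other gap. Hence G = 1
+ X(2GFG - G), where F counts the middle blocks: F = 1 without descents, and otherwise, by
reflection, F is the series of the trees without descents.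

With A = 1/(1 + X) and C the Catalan series, the unique solution is G = A C(2XFA²). For F = 1 the
little Schröder numbers satisfy the same equation; for F = A C(2XA²), expanding in powers of F, C
and A gives the triple sum. -/

/-! ### Non-crossing parent functions with jump sets -/

/-- The chords `{x, x'}` and `{y, y'}` do not cross with the smaller endpoint of the first one
coming first. -/
def NotCrossing (x x' y y' : ℕ) : Prop :=
  ¬ (min x x' < min y y' ∧ min y y' < max x x' ∧ max x x' < max y y')

/-- `p` is the parent function of a non-crossing tree on the points `a, …, b` with root `a` in which
descents are followed by descents only, `B` is the set of gaps `g, g + 1` at which the label jumps,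
and there are no level edges. If `e` is `false`, then there are no descents at all. -/
structure IsParentFn (e : Bool) (a b : ℕ) (p : ℕ → ℕ) (B : Finset ℕ) : Prop where
  out : ∀ w, ¬ (a < w ∧ w ≤ b) → p w = 0
  jumps : ∀ g ∈ B, a ≤ g ∧ g < b
  bounds : ∀ w, a < w → w ≤ b → a ≤ p w ∧ p w ≤ b ∧ p w ≠ w
  nc : ∀ x y, a < x → x ≤ b → a < y → y ≤ b → NotCrossing x (p x) y (p y)
  desc : ∀ x, a < x → x ≤ b → a < p x → p x < p (p x) → x < p x
  asc : e = false → ∀ x, a < x → x ≤ b → p x < x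
  jump : ∀ x, a < x → x ≤ b → ∃ g ∈ B, min x (p x) ≤ g ∧ g < max x (p x)

/-- `p` is the parent function of a non-crossing tree on the points `a, …, b` with root `b` in which
all edges are descents, `B` being the set of gaps at which the label jumps. If `e` is `false`,
then the tree has one vertex. -/
structure IsDescFn (e : Bool) (a b : ℕ) (p : ℕ → ℕ) (B : Finset ℕ) : Prop where
  out : ∀ w, ¬ (a ≤ w ∧ w < b) → p w = 0
  jumps : ∀ g ∈ B, a ≤ g ∧ g < b
  bounds : ∀ w, a ≤ w → w < b → w < p w ∧ p w ≤ b
  nc : ∀ x y, a ≤ x → x < b → a ≤ y → y < b → NotCrossing x (p x) y (p y)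
  single : e = false → a = b
  jump : ∀ x, a ≤ x → x < b → ∃ g ∈ B, x ≤ g ∧ g < p x

theorem finite_of_bounded (N : ℕ) (S : Set ((ℕ → ℕ) × Finset ℕ))
    (h1 : ∀ x ∈ S, ∀ w, x.1 w ≤ N) (h2 : ∀ x ∈ S, ∀ w, N < w → x.1 w = 0)
    (h3 : ∀ x ∈ S, x.2 ⊆ Finset.range N) : S.Finite := by
  refine Set.Finite.of_injOn (f := fun x => ((fun w : Fin (N + 1) => (x.1 w : ℕ)), x.2))
    (t := Set.pi Set.univ (fun _ : Fin (N + 1) => Set.Iic N) ×ˢ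
      ((Finset.range N).powerset : Set (Finset ℕ))) ?_ ?_ ?_
  · intro x hx
    simp only [Set.mem_prod, Set.mem_pi, Set.mem_univ, Set.mem_Iic, forall_const, Finset.mem_coe,
      Finset.mem_powerset]
    exact ⟨fun w => h1 x hx w, h3 x hx⟩
  · intro x hx y hy hxy
    simp only [Prod.mk.injEq] at hxy
    refine Prod.ext (funext fun w => ?_) hxy.2
    by_cases hw : w ≤ N
    · exact congrFun hxy.1 ⟨w, by omega⟩
    · rw [h2 x hx w (by omega), h2 y hy w (by omega)]
  · exact (Set.Finite.pi fun _ => Set.finite_Iic N).prod (Finset.finite_toSet _)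

theorem finite_isParentFn (e : Bool) (a b : ℕ) :
    {x : (ℕ → ℕ) × Finset ℕ | IsParentFn e a b x.1 x.2}.Finite := by
  refine finite_of_bounded b _ ?_ ?_ ?_
  · intro x hx w
    rw [Set.mem_ofPred_eq] at hx
    by_cases hw : a < w ∧ w ≤ b
    · exact (hx.bounds w hw.1 hw.2).2.1
    · simp [hx.out w hw]
  · intro x hx w hw
    rw [Set.mem_ofPred_eq] at hx
    exact hx.out w (by omega)
  · intro x hx g hg
    exact Finset.mem_range.2 (hx.jumps g hg).2

theorem finite_isDescFn (e : Bool) (a b : ℕ) :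
    {x : (ℕ → ℕ) × Finset ℕ | IsDescFn e a b x.1 x.2}.Finite := by
  refine finite_of_bounded b _ ?_ ?_ ?_
  · intro x hx w
    rw [Set.mem_ofPred_eq] at hx
    by_cases hw : a ≤ w ∧ w < b
    · exact (hx.bounds w hw.1 hw.2).2
    · simp [hx.out w hw]
  · intro x hx w hw
    rw [Set.mem_ofPred_eq] at hx
    exact hx.out w (by omega)
  · intro x hx g hg
    exact Finset.mem_range.2 (hx.jumps g hg).2

/-- The finite set of the pairs `(p, B)` satisfying `IsParentFn`. -/
noncomputable def parentFns (e : Bool) (a b : ℕ) : Finset ((ℕ → ℕ) × Finset ℕ) :=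
  (finite_isParentFn e a b).toFinset

/-- The finite set of the pairs `(p, B)` satisfying `IsDescFn`. -/
noncomputable def descFns (e : Bool) (a b : ℕ) : Finset ((ℕ → ℕ) × Finset ℕ) :=
  (finite_isDescFn e a b).toFinset

theorem mem_parentFns {e : Bool} {a b : ℕ} {x : (ℕ → ℕ) × Finset ℕ} :
    x ∈ parentFns e a b ↔ IsParentFn e a b x.1 x.2 := by simp [parentFns]

theorem mem_descFns {e : Bool} {a b : ℕ} {x : (ℕ → ℕ) × Finset ℕ} :
    x ∈ descFns e a b ↔ IsDescFn e a b x.1 x.2 := by simp [descFns]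

/-! ### Decomposition at the last child of the root -/

/-- Gluing of parent functions on `[a, m]`, `[m + 1, c]` and `[c, b]` with the edge `{a, c}`. -/
def glueFn (a m c : ℕ) (p₁ p₂ p₃ : ℕ → ℕ) (w : ℕ) : ℕ :=
  if w ≤ m then p₁ w else if w < c then p₂ w else if w = c then a else p₃ w

/-- Gluing of the sets of jumps; `t` tells whether there is a jump at the gap `m, m + 1`. -/
def glueJumps (m : ℕ) (B₁ B₂ B₃ : Finset ℕ) (t : Bool) : Finset ℕ :=
  B₁ ∪ (B₂ ∪ (B₃ ∪ if t then {m} else ∅))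

theorem mem_glueJumps {m : ℕ} {B₁ B₂ B₃ : Finset ℕ} {t : Bool} {g : ℕ} :
    g ∈ glueJumps m B₁ B₂ B₃ t ↔ g ∈ B₁ ∨ g ∈ B₂ ∨ g ∈ B₃ ∨ (t = true ∧ g = m) := by
  cases t <;> simp only [glueJumps] <;> grind

theorem glueFn_le {a m c : ℕ} {p₁ p₂ p₃ : ℕ → ℕ} {w : ℕ} (h : w ≤ m) :
    glueFn a m c p₁ p₂ p₃ w = p₁ w := by simp [glueFn, h]

theorem glueFn_mid {a m c : ℕ} {p₁ p₂ p₃ : ℕ → ℕ} {w : ℕ} (h : m < w) (h' : w < c) :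
    glueFn a m c p₁ p₂ p₃ w = p₂ w := by simp [glueFn, h.not_ge, h']

theorem glueFn_self {a m c : ℕ} {p₁ p₂ p₃ : ℕ → ℕ} (h : m < c) :
    glueFn a m c p₁ p₂ p₃ c = a := by simp [glueFn, h.not_ge]

theorem glueFn_gt {a m c : ℕ} {p₁ p₂ p₃ : ℕ → ℕ} {w : ℕ} (h' : m < c) (h : c < w) :
    glueFn a m c p₁ p₂ p₃ w = p₃ w := by
  simp [glueFn, (h'.trans h).not_ge, h.not_gt, h.ne']

theorem IsParentFn.glue {e t : Bool} {a b m c : ℕ} {p₁ p₂ p₃ : ℕ → ℕ} {B₁ B₂ B₃ : Finset ℕ}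
    (ham : a ≤ m) (hmc : m < c) (hcb : c ≤ b)
    (h₁ : IsParentFn e a m p₁ B₁) (h₂ : IsDescFn e (m + 1) c p₂ B₂) (h₃ : IsParentFn e c b p₃ B₃)
    (ht : m = a → c = m + 1 → t = true) :
    IsParentFn e a b (glueFn a m c p₁ p₂ p₃) (glueJumps m B₁ B₂ B₃ t) := by
  set p := glueFn a m c p₁ p₂ p₃ with hp
  have key : ∀ w, a < w → w ≤ b →
      (w ≤ m ∧ p w = p₁ w ∧ a ≤ p w ∧ p w ≤ m ∧ p w ≠ w) ∨
      (m < w ∧ w < c ∧ p w = p₂ w ∧ w < p w ∧ p w ≤ c) ∨ (w = c ∧ p w = a) ∨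
      (c < w ∧ p w = p₃ w ∧ c ≤ p w ∧ p w ≤ b ∧ p w ≠ w) := by
    intro w hw hw'
    rcases le_or_gt w m with h | h
    · have := h₁.bounds w hw h
      rw [hp, glueFn_le h]; omega
    rcases lt_trichotomy w c with h' | h' | h'
    · have := h₂.bounds w h h'
      rw [hp, glueFn_mid h h']; omega
    · subst h'
      rw [hp, glueFn_self hmc]; omega
    · have := h₃.bounds w h' hw'
      rw [hp, glueFn_gt hmc h']; omega
  refine ⟨?_, ?_, ?_, ?_, ?_, ?_, ?_⟩
  · intro w hw
    rcases le_or_gt w a with h | h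
    · rw [hp, glueFn_le (by omega)]; exact h₁.out w (by omega)
    · rw [hp, glueFn_gt hmc (by omega)]; exact h₃.out w (by omega)
  · intro g hg
    rcases mem_glueJumps.1 hg with h | h | h | h
    · have := h₁.jumps g h; omega
    · have := h₂.jumps g h; omega
    · have := h₃.jumps g h; omega
    · omega
  · intro w hw hw'
    have := key w hw hw'; omega
  · intro x y hx hx' hy hy'
    have kx := key x hx hx'
    have ky := key y hy hy'
    rcases kx with kx | kx | kx | kx <;> rcases ky with ky | ky | ky | ky
    · rw [kx.2.1, ky.2.1]; exact h₁.nc x y hx kx.1 hy ky.1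
    all_goals first
      | (unfold NotCrossing; omega)
      | skip
    · rw [kx.2.2.1, ky.2.2.1]; exact h₂.nc x y kx.1 kx.2.1 ky.1 ky.2.1
    · rw [kx.2.1, ky.2.1]; exact h₃.nc x y kx.1 hx' ky.1 hy'
  · intro x hx hx' hpx hpp
    rcases key x hx hx' with kx | kx | kx | kx
    · have ky := key (p x) hpx (by omega)
      have := h₁.desc x hx kx.1
      rw [← kx.2.1] at this
      have h2 : p (p x) = p₁ (p x) := by omega
      rw [← h2] at this
      exact this hpx hpp
    · omega
    · omega
    · have ky := key (p x) hpx (by omega)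
      have := h₃.desc x kx.1 hx'
      rw [← kx.2.1] at this
      have h3 : c < p x → p (p x) = p₃ (p x) := by omega
      rcases eq_or_lt_of_le kx.2.2.1 with hc | hc
      · omega
      rw [← h3 hc] at this
      exact this hc hpp
  · intro he x hx hx'
    have := h₂.single he
    rcases key x hx hx' with kx | kx | kx | kx
    · have := h₁.asc he x hx kx.1; omega
    · omega
    · omega
    · have := h₃.asc he x kx.1 hx'; omega
  · intro x hx hx'
    simp only [mem_glueJumps]
    rcases key x hx hx' with kx | kx | kx | kx
    · obtain ⟨g, hg, hg'⟩ := h₁.jump x hx kx.1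
      exact ⟨g, Or.inl hg, by rw [kx.2.1]; exact hg'⟩
    · obtain ⟨g, hg, hg'⟩ := h₂.jump x kx.1 kx.2.1
      exact ⟨g, Or.inr (Or.inl hg), by omega⟩
    -- The new chord `{a, c}` must span a jump. If one of the first two blocks has an edge, that
    -- edge already spans one; otherwise gap `m` is the only candidate.
    · rcases eq_or_lt_of_le ham with h | h
      · rcases eq_or_lt_of_le (Nat.succ_le_of_lt hmc) with h' | h'
        · exact ⟨m, Or.inr (Or.inr (Or.inr ⟨ht h.symm h'.symm, rfl⟩)), by omega⟩
        · obtain ⟨g, hg, hg'⟩ := h₂.jump (m + 1) le_rfl h'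
          have := h₂.jumps g hg
          exact ⟨g, Or.inr (Or.inl hg), by omega⟩
      · obtain ⟨g, hg, hg'⟩ := h₁.jump m h le_rfl
        have := h₁.jumps g hg
        exact ⟨g, Or.inl hg, by omega⟩
    · obtain ⟨g, hg, hg'⟩ := h₃.jump x kx.1 hx'
      exact ⟨g, Or.inr (Or.inr (Or.inl hg)), by rw [kx.2.1]; exact hg'⟩

/-- Off the block both functions have the default value 0, so that pairs can be counted without
overcounting. -/
theorem IsParentFn.ext_of_eqOn {e : Bool} {a b : ℕ} {p q : ℕ → ℕ} {B C : Finset ℕ}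
    (hp : IsParentFn e a b p B) (hq : IsParentFn e a b q C)
    (h : ∀ w, a < w → w ≤ b → p w = q w) : p = q := by
  funext w
  by_cases hw : a < w ∧ w ≤ b
  · exact h w hw.1 hw.2
  · rw [hp.out w hw, hq.out w hw]

theorem IsDescFn.ext_of_eqOn {e : Bool} {a b : ℕ} {p q : ℕ → ℕ} {B C : Finset ℕ}
    (hp : IsDescFn e a b p B) (hq : IsDescFn e a b q C)
    (h : ∀ w, a ≤ w → w < b → p w = q w) : p = q := by
  funext w
  by_cases hw : a ≤ w ∧ w < b
  · exact h w hw.1 hw.2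
  · rw [hp.out w hw, hq.out w hw]

/-- The vertex `c` and the gap `m` are determined by the glued function. -/
theorem glueFn_unique {e : Bool} {a b m c m' c' : ℕ} {p₁ p₂ p₃ q₁ q₂ q₃ : ℕ → ℕ}
    {B₂ B₃ C₁ : Finset ℕ} (ham : a ≤ m) (hmc : m < c)
    (h₂ : IsDescFn e (m + 1) c p₂ B₂) (h₃ : IsParentFn e c b p₃ B₃)
    (ham' : a ≤ m') (hmc' : m' < c') (hcb' : c' ≤ b)
    (k₁ : IsParentFn e a m' q₁ C₁)
    (h : glueFn a m c p₁ p₂ p₃ = glueFn a m' c' q₁ q₂ q₃) : c' ≤ c ∧ (c = c' → m' ≤ m) := by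
  constructor
  -- Beyond `c` all parents are at least `c > a`, so no child of `a` lies there.
  · by_contra hlt
    have e1 := congrFun h c'
    rw [glueFn_self hmc', glueFn_gt hmc (by omega)] at e1
    have := h₃.bounds c' (by omega) hcb'
    omega
  · rintro rfl
    -- Strictly between `m` and `c` all edges go left, whereas the last point `m'` of a block rooted
    -- at `a` has its parent on its left.
    by_contra hlt
    have e1 := congrFun h m'
    rw [glueFn_mid (by omega) hmc', glueFn_le le_rfl] at e1
    have b2 := h₂.bounds m' (by omega) hmc'
    have b1 := k₁.bounds m' (by omega) le_rfl
    omega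

/-- The gaps inside the three blocks and the gap `m` are pairwise disjoint, so each part can be read
off from the union. -/
theorem glue_injective {e t t' : Bool} {a b m c : ℕ} {p₁ p₂ p₃ q₁ q₂ q₃ : ℕ → ℕ}
    {B₁ B₂ B₃ C₁ C₂ C₃ : Finset ℕ} (hmc : m < c)
    (h₁ : IsParentFn e a m p₁ B₁) (h₂ : IsDescFn e (m + 1) c p₂ B₂) (h₃ : IsParentFn e c b p₃ B₃)
    (k₁ : IsParentFn e a m q₁ C₁) (k₂ : IsDescFn e (m + 1) c q₂ C₂)
    (k₃ : IsParentFn e c b q₃ C₃)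
    (h : glueFn a m c p₁ p₂ p₃ = glueFn a m c q₁ q₂ q₃)
    (hB : glueJumps m B₁ B₂ B₃ t = glueJumps m C₁ C₂ C₃ t') :
    (p₁ = q₁ ∧ B₁ = C₁) ∧ (p₂ = q₂ ∧ B₂ = C₂) ∧ (p₃ = q₃ ∧ B₃ = C₃) ∧ t = t' := by
  have hB' : ∀ g, (g ∈ B₁ ∨ g ∈ B₂ ∨ g ∈ B₃ ∨ (t = true ∧ g = m)) ↔
      (g ∈ C₁ ∨ g ∈ C₂ ∨ g ∈ C₃ ∨ (t' = true ∧ g = m)) := fun g => by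
    rw [← mem_glueJumps, ← mem_glueJumps, hB]
  have b1 := h₁.jumps
  have b2 := h₂.jumps
  have b3 := h₃.jumps
  have c1 := k₁.jumps
  have c2 := k₂.jumps
  have c3 := k₃.jumps
  refine ⟨⟨h₁.ext_of_eqOn k₁ ?_, ?_⟩, ⟨h₂.ext_of_eqOn k₂ ?_, ?_⟩, ⟨h₃.ext_of_eqOn k₃ ?_, ?_⟩, ?_⟩
  · intro w _ hw
    have := congrFun h w
    rwa [glueFn_le hw, glueFn_le hw] at this
  · ext g
    have := hB' g; have := b1 g; have := b2 g; have := b3 g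
    have := c1 g; have := c2 g; have := c3 g
    grind
  · intro w hw hw'
    have := congrFun h w
    rwa [glueFn_mid hw hw', glueFn_mid hw hw'] at this
  · ext g
    have := hB' g; have := b1 g; have := b2 g; have := b3 g
    have := c1 g; have := c2 g; have := c3 g
    grind
  · intro w hw hw'
    have := congrFun h w
    rwa [glueFn_gt hmc hw, glueFn_gt hmc hw] at this
  · ext g
    have := hB' g; have := b1 g; have := b2 g; have := b3 g
    have := c1 g; have := c2 g; have := c3 g
    grind
  · have := hB' m; have := b1 m; have := b2 m; have := b3 m
    have := c1 m; have := c2 m; have := c3 m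
    cases t <;> cases t' <;> grind

/-- The vertices under a descent all have larger parents. -/
theorem IsParentFn.lt_of_under {e : Bool} {a b : ℕ} {p : ℕ → ℕ} {B : Finset ℕ}
    (h : IsParentFn e a b p B) {w : ℕ} (hw : a < w) (hwb : w ≤ b) (hpw : w < p w) :
    ∀ v, w < v → v < p w → v < p v := by
  intro v
  induction v using Nat.strong_induction_on with
  | _ v ih =>
    intro hv hv'
    have bw := h.bounds w hw hwb
    have bv := h.bounds v (by omega) (by omega)
    by_contra hlt
    have nc := h.nc w v hw hwb (by omega) (by omega)
    have nc' := h.nc v w (by omega) (by omega) hw hwb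
    have hd := h.desc v (by omega) (by omega)
    unfold NotCrossing at nc nc'
    -- Otherwise the chords at `v` and `w` would cross. So `p v` is `w` or again lies under the
    -- descent to `w`; either way it is reached by a left edge, which forces one to `v`.
    have hle : w ≤ p v := by omega
    rcases eq_or_lt_of_le hle with hpv | hpv
    · rw [← hpv] at hd
      have := hd hw hpw
      omega
    · have := ih (p v) (by omega) hpv (by omega)
      have := hd (by omega) this
      omega

/-- Take the least vertex reached by a right edge. If its parent were not the root, that smaller
vertex would be reached by a left edge, which cannot be followed by a right one. -/
theorem IsParentFn.exists_child {e : Bool} {a b : ℕ} {p : ℕ → ℕ} {B : Finset ℕ}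
    (h : IsParentFn e a b p B) (hab : a < b) : ∃ c, a < c ∧ c ≤ b ∧ p c = a := by
  classical
  have hex : ∃ c, a < c ∧ c ≤ b ∧ p c < c := by
    have := h.bounds b hab le_rfl
    exact ⟨b, hab, le_rfl, by omega⟩
  obtain ⟨h1, h2, h3⟩ := Nat.find_spec hex
  set c := Nat.find hex
  refine ⟨c, h1, h2, ?_⟩
  by_contra hne
  have bc := h.bounds c h1 h2
  have hmin := Nat.find_min hex (m := p c) h3
  have bpc := h.bounds (p c) (by omega) (by omega)
  have := h.desc c h1 h2 (by omega) (by omega)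
  omega

theorem IsParentFn.exists_split {e : Bool} {a b : ℕ} {p : ℕ → ℕ} {B : Finset ℕ}
    (h : IsParentFn e a b p B) (hab : a < b) :
    ∃ m c, a ≤ m ∧ m < c ∧ c ≤ b ∧ p c = a ∧ (∀ w, c < w → w ≤ b → p w ≠ a) ∧
      (m = a ∨ p m < m) ∧ ∀ w, m < w → w < c → w < p w := by
  classical
  obtain ⟨c₀, h1, h2, h3⟩ := h.exists_child hab
  have hc := Nat.findGreatest_spec (P := fun c => a < c ∧ p c = a) h2 ⟨h1, h3⟩
  have hcb := Nat.findGreatest_le (P := fun c => a < c ∧ p c = a) b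
  have hcm := fun w => Nat.findGreatest_is_greatest (P := fun c => a < c ∧ p c = a) (n := b) (k := w)
  set c := Nat.findGreatest (fun c => a < c ∧ p c = a) b
  have hm := Nat.findGreatest_spec (P := fun m => m = a ∨ (a < m ∧ p m < m)) (n := c - 1) (m := a)
    (by omega) (Or.inl rfl)
  have hmc := Nat.findGreatest_le (P := fun m => m = a ∨ (a < m ∧ p m < m)) (c - 1)
  have hmm := fun w => Nat.findGreatest_is_greatest (P := fun m => m = a ∨ (a < m ∧ p m < m))
    (n := c - 1) (k := w)
  set m := Nat.findGreatest (fun m => m = a ∨ (a < m ∧ p m < m)) (c - 1)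
  refine ⟨m, c, by omega, by omega, hcb, hc.2, ?_, by omega, ?_⟩
  · intro w hw hw' hpw
    exact hcm w hw hw' ⟨by omega, hpw⟩
  · intro w hw hw'
    have := hmm w hw (by omega)
    have := h.bounds w (by omega) (by omega)
    omega

theorem IsParentFn.exists_glue {e : Bool} {a b : ℕ} {p : ℕ → ℕ} {B : Finset ℕ}
    (h : IsParentFn e a b p B) (hab : a < b) :
    ∃ m c p₁ B₁ p₂ B₂ p₃ B₃ t, a ≤ m ∧ m < c ∧ c ≤ b ∧ IsParentFn e a m p₁ B₁ ∧
      IsDescFn e (m + 1) c p₂ B₂ ∧ IsParentFn e c b p₃ B₃ ∧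
      (m = a → c = m + 1 → t = true) ∧
      glueFn a m c p₁ p₂ p₃ = p ∧ glueJumps m B₁ B₂ B₃ t = B := by
  classical
  obtain ⟨m, c, ham, hmc, hcb, hpc, hlast, hm, hmid⟩ := h.exists_split hab
  have key : ∀ w, a < w → w ≤ b →
      (w ≤ m ∧ a ≤ p w ∧ p w ≤ m ∧ p w ≠ w) ∨
      (m < w ∧ w < c ∧ w < p w ∧ p w ≤ c) ∨ (w = c ∧ p w = a) ∨
      (c < w ∧ c ≤ p w ∧ p w ≤ b ∧ p w ≠ w) := by
    intro w hw hw'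
    have bw := h.bounds w hw hw'
    have nc := h.nc w c hw hw' (by omega) hcb
    have nc' := h.nc c w (by omega) hcb hw hw'
    unfold NotCrossing at nc nc'
    rw [hpc] at nc nc'
    rcases le_or_gt w m with hwm | hwm
    · left
      refine ⟨hwm, bw.1, ?_, bw.2.2⟩
      by_contra hlt
      rcases eq_or_lt_of_le hwm with rfl | hlt'
      · omega
      -- A parent beyond `m` would put `m` under a left edge, but `m` is reached by a right edge.
      · have := h.lt_of_under hw hw' (by omega) m hlt' (by omega)
        omega
    · rcases lt_trichotomy w c with h' | h' | h'
      · have := hmid w hwm h'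
        omega
      · subst h'; omega
      · have := hlast w h' hw'
        omega
  refine ⟨m, c, fun w => if a < w ∧ w ≤ m then p w else 0, B.filter (· < m),
    fun w => if m + 1 ≤ w ∧ w < c then p w else 0, B.filter (fun g => m < g ∧ g < c),
    fun w => if c < w ∧ w ≤ b then p w else 0, B.filter (c ≤ ·), decide (m ∈ B),
    ham, hmc, hcb, ?_, ?_, ?_, ?_, ?_, ?_⟩
  · refine ⟨fun w hw => if_neg hw, ?_, ?_, ?_, ?_, ?_, ?_⟩
    · intro g hg
      rw [Finset.mem_filter] at hg
      exact ⟨(h.jumps g hg.1).1, hg.2⟩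
    · intro w hw hw'
      have := key w hw (by omega)
      simp only [hw, hw', and_self, if_true]
      omega
    · intro x y hx hx' hy hy'
      simp only [hx, hx', hy, hy', and_self, if_true]
      exact h.nc x y hx (by omega) hy (by omega)
    · intro x hx hx'
      have := key x hx (by omega)
      simp only [hx, hx', and_self, if_true]
      intro h1
      have h2 : p x ≤ m := by omega
      simp only [h1, h2, and_self, if_true]
      exact h.desc x hx (by omega) h1
    · intro he x hx hx'
      simp only [hx, hx', and_self, if_true]
      exact h.asc he x hx (by omega)
    · intro x hx hx'
      have := key x hx (by omega)
      simp only [hx, hx', and_self, if_true]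
      obtain ⟨g, hg, hg'⟩ := h.jump x hx (by omega)
      exact ⟨g, Finset.mem_filter.2 ⟨hg, by omega⟩, hg'⟩
  · refine ⟨fun w hw => if_neg hw, ?_, ?_, ?_, ?_, ?_⟩
    · intro g hg
      rw [Finset.mem_filter] at hg
      omega
    · intro w hw hw'
      have := key w (by omega) (by omega)
      simp only [hw, hw', and_self, if_true]
      omega
    · intro x y hx hx' hy hy'
      simp only [hx, hx', hy, hy', and_self, if_true]
      exact h.nc x y (by omega) (by omega) (by omega) (by omega)
    · intro he
      by_contra hne
      have := h.asc he (m + 1) (by omega) (by omega)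
      have := hmid (m + 1) (by omega) (by omega)
      omega
    · intro x hx hx'
      have := key x (by omega) (by omega)
      simp only [hx, hx', and_self, if_true]
      obtain ⟨g, hg, hg'⟩ := h.jump x (by omega) (by omega)
      exact ⟨g, Finset.mem_filter.2 ⟨hg, by omega⟩, by omega⟩
  · refine ⟨fun w hw => if_neg hw, ?_, ?_, ?_, ?_, ?_, ?_⟩
    · intro g hg
      rw [Finset.mem_filter] at hg
      exact ⟨hg.2, (h.jumps g hg.1).2⟩
    · intro w hw hw'
      have := key w (by omega) hw'
      simp only [hw, hw', and_self, if_true]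
      omega
    · intro x y hx hx' hy hy'
      simp only [hx, hx', hy, hy', and_self, if_true]
      exact h.nc x y (by omega) hx' (by omega) hy'
    · intro x hx hx'
      have := key x (by omega) hx'
      simp only [hx, hx', and_self, if_true]
      intro h1
      have h2 : p x ≤ b := by omega
      simp only [h1, h2, and_self, if_true]
      exact h.desc x (by omega) hx' (by omega)
    · intro he x hx hx'
      simp only [hx, hx', and_self, if_true]
      exact h.asc he x (by omega) hx'
    · intro x hx hx'
      have := key x (by omega) hx'
      simp only [hx, hx', and_self, if_true]
      obtain ⟨g, hg, hg'⟩ := h.jump x (by omega) hx'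
      exact ⟨g, Finset.mem_filter.2 ⟨hg, by omega⟩, hg'⟩
  · intro hma hcm
    obtain ⟨g, hg, hg'⟩ := h.jump c (by omega) hcb
    have : g = m := by omega
    simpa [← this] using hg
  · funext w
    have := h.out w
    unfold glueFn
    split_ifs <;> grind
  · ext g
    rw [mem_glueJumps]
    have := h.jumps g
    simp only [Finset.mem_filter, decide_eq_true_eq]
    grind

/-! ### Recurrence for the number of pairs -/

open Finset in
-- The indices are the numbers of edges `m - a`, `c - m - 1` and `b - c` of the three blocks; the
-- edge `{a, c}` accounts for the remaining one.
theorem card_parentFns_succ (e : Bool) (a n : ℕ) :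
    #(parentFns e a (a + (n + 1))) =
      ∑ x ∈ antidiagonal n, ∑ y ∈ antidiagonal x.2,
        (if x.1 = 0 ∧ y.1 = 0 then 1 else 2) * (#(parentFns e a (a + x.1)) *
          (#(descFns e (a + x.1 + 1) (a + x.1 + 1 + y.1)) *
            #(parentFns e (a + x.1 + 1 + y.1) (a + x.1 + 1 + y.1 + y.2)))) := by
  classical
  -- The weight is the number of admissible bits for gap `m`, which makes the right side the
  -- cardinality of a sigma type.
  have hbits : ∀ i j : ℕ, (if i = 0 ∧ j = 0 then 1 else 2) =
      #(univ.filter fun t : Bool => i = 0 ∧ j = 0 → t = true) := by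
    intro i j
    by_cases h : i = 0 ∧ j = 0
    · simp only [h]; decide
    · simp [h]
  simp_rw [hbits, ← card_product]
  rw [sum_sigma', ← card_sigma]
  symm
  refine card_bij (fun z _ => (glueFn a (a + z.1.1.1) (a + z.1.1.1 + 1 + z.1.2.1)
      z.2.2.1.1 z.2.2.2.1.1 z.2.2.2.2.1,
    glueJumps (a + z.1.1.1) z.2.2.1.2 z.2.2.2.1.2 z.2.2.2.2.2 z.2.1)) ?_ ?_ ?_
  · rintro ⟨⟨⟨i, q⟩, ⟨j, k⟩⟩, t, ⟨p₁, B₁⟩, ⟨p₂, B₂⟩, ⟨p₃, B₃⟩⟩ hz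
    simp only [mem_sigma, HasAntidiagonal.mem_antidiagonal, mem_product, mem_filter, mem_univ, true_and,
      mem_parentFns, mem_descFns] at hz ⊢
    obtain ⟨⟨h1, h2⟩, h3, h4, h5, h6⟩ := hz
    have hb : a + i + 1 + j + k = a + (n + 1) := by omega
    rw [hb] at h6
    exact IsParentFn.glue (by omega) (by omega) (by omega) h4 h5 h6
      fun hi hj => h3 ⟨by omega, by omega⟩
  · rintro ⟨⟨⟨i, q⟩, ⟨j, k⟩⟩, t, ⟨p₁, B₁⟩, ⟨p₂, B₂⟩, ⟨p₃, B₃⟩⟩ hz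
      ⟨⟨⟨i', q'⟩, ⟨j', k'⟩⟩, t', ⟨q₁, C₁⟩, ⟨q₂, C₂⟩, ⟨q₃, C₃⟩⟩ hz' heq
    simp only [mem_sigma, HasAntidiagonal.mem_antidiagonal, mem_product, mem_filter, mem_univ, true_and,
      mem_parentFns, mem_descFns] at hz hz'
    obtain ⟨⟨h1, h2⟩, h3, h4, h5, h6⟩ := hz
    obtain ⟨⟨h1', h2'⟩, h3', h4', h5', h6'⟩ := hz'
    have hb : a + i + 1 + j + k = a + (n + 1) := by omega
    have hb' : a + i' + 1 + j' + k' = a + (n + 1) := by omega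
    rw [hb] at h6
    rw [hb'] at h6'
    simp only [Prod.mk.injEq] at heq
    have u1 := glueFn_unique (by omega) (by omega) h5 h6 (by omega) (by omega) (by omega) h4' heq.1
    have u2 := glueFn_unique (by omega) (by omega) h5' h6' (by omega) (by omega) (by omega) h4
      heq.1.symm
    have hc : a + i + 1 + j = a + i' + 1 + j' := by omega
    have hm := u1.2 hc
    have hm' := u2.2 hc.symm
    obtain rfl : i = i' := by omega
    obtain rfl : j = j' := by omega
    obtain rfl : q = q' := by omega
    obtain rfl : k = k' := by omega
    obtain ⟨⟨rfl, rfl⟩, ⟨rfl, rfl⟩, ⟨rfl, rfl⟩, rfl⟩ :=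
      glue_injective (by omega) h4 h5 h6 h4' h5' h6' heq.1 heq.2
    rfl
  · rintro ⟨p, B⟩ hp
    rw [mem_parentFns] at hp
    obtain ⟨m, c, p₁, B₁, p₂, B₂, p₃, B₃, t, ham, hmc, hcb, h1, h2, h3, ht, rfl, rfl⟩ :=
      hp.exists_glue (by omega)
    obtain ⟨i, rfl⟩ := Nat.exists_eq_add_of_le ham
    obtain ⟨j, rfl⟩ := Nat.exists_eq_add_of_le (Nat.succ_le_of_lt hmc)
    obtain ⟨k, hk⟩ := Nat.exists_eq_add_of_le hcb
    refine ⟨⟨⟨⟨i, j + k⟩, ⟨j, k⟩⟩, t, ⟨p₁, B₁⟩, ⟨p₂, B₂⟩, ⟨p₃, B₃⟩⟩, ?_, rfl⟩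
    simp only [mem_sigma, HasAntidiagonal.mem_antidiagonal, mem_product, mem_filter, mem_univ, true_and,
      mem_parentFns, mem_descFns]
    rw [hk] at h3
    exact ⟨⟨by omega, trivial⟩, fun h => ht (by omega) (by omega), h1, h2, h3⟩

theorem card_parentFns_self (e : Bool) (a : ℕ) : (parentFns e a a).card = 1 := by
  rw [Finset.card_eq_one]
  refine ⟨(fun _ => 0, ∅), ?_⟩
  ext ⟨p, B⟩
  rw [mem_parentFns, Finset.mem_singleton, Prod.mk.injEq]
  constructor
  · intro h
    refine ⟨funext fun w => h.out w (by omega), Finset.eq_empty_of_forall_notMem fun g hg => ?_⟩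
    have := h.jumps g hg
    omega
  · rintro ⟨rfl, rfl⟩
    constructor <;> intros <;> first | rfl | omega | simp_all

theorem card_descFns_false (a j : ℕ) :
    (descFns false a (a + j)).card = if j = 0 then 1 else 0 := by
  split_ifs with hj
  · subst hj
    rw [Finset.card_eq_one]
    refine ⟨(fun _ => 0, ∅), ?_⟩
    ext ⟨p, B⟩
    rw [mem_descFns, Finset.mem_singleton, Prod.mk.injEq]
    constructor
    · intro h
      refine ⟨funext fun w => h.out w (by omega), Finset.eq_empty_of_forall_notMem fun g hg => ?_⟩
      have := h.jumps g hg
      omega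
    · rintro ⟨rfl, rfl⟩
      constructor <;> intros <;> first | rfl | omega | simp_all
  · rw [Finset.card_eq_zero]
    refine Finset.eq_empty_of_forall_notMem fun x hx => ?_
    have := (mem_descFns.1 hx).single rfl
    omega

/-- The reflection `w ↦ a + b - w` exchanges left and right edges and sends the gap `g` to `a + b -
1 - g`. -/
theorem card_descFns_true (a b : ℕ) :
    (descFns true a b).card = (parentFns false a b).card := by
  classical
  refine Finset.card_nbij'
    (fun x => (fun w => if a < w ∧ w ≤ b then a + b - x.1 (a + b - w) else 0,
      x.2.image (fun g => a + b - 1 - g)))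
    (fun x => (fun w => if a ≤ w ∧ w < b then a + b - x.1 (a + b - w) else 0,
      x.2.image (fun g => a + b - 1 - g))) ?_ ?_ ?_ ?_
  · rintro ⟨p, B⟩ hx
    simp only [Finset.mem_coe, mem_descFns, mem_parentFns] at hx ⊢
    refine ⟨fun w hw => if_neg hw, ?_, ?_, ?_, ?_, ?_, ?_⟩
    · intro g hg
      obtain ⟨g', hg', rfl⟩ := Finset.mem_image.1 hg
      have := hx.jumps g' hg'
      omega
    · intro w hw hw'
      have := hx.bounds (a + b - w) (by omega) (by omega)
      simp only [hw, hw', and_self, if_true]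
      omega
    · intro x y h1 h2 h3 h4
      have := hx.bounds (a + b - x) (by omega) (by omega)
      have := hx.bounds (a + b - y) (by omega) (by omega)
      have := hx.nc (a + b - y) (a + b - x) (by omega) (by omega) (by omega) (by omega)
      simp only [h1, h2, h3, h4, and_self, if_true]
      unfold NotCrossing at *
      omega
    · intro x h1 h2
      have := hx.bounds (a + b - x) (by omega) (by omega)
      simp only [h1, h2, and_self, if_true]
      intro h3
      have h4 : a + b - p (a + b - x) ≤ b := by omega
      simp only [h3, h4, and_self, if_true]
      have := hx.bounds (a + b - (a + b - p (a + b - x))) (by omega) (by omega)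
      omega
    · intro _ x h1 h2
      have := hx.bounds (a + b - x) (by omega) (by omega)
      simp only [h1, h2, and_self, if_true]
      omega
    · intro x h1 h2
      have := hx.bounds (a + b - x) (by omega) (by omega)
      obtain ⟨g, hg, hg'⟩ := hx.jump (a + b - x) (by omega) (by omega)
      simp only [h1, h2, and_self, if_true]
      exact ⟨a + b - 1 - g, Finset.mem_image_of_mem _ hg, by omega⟩
  · rintro ⟨p, B⟩ hx
    simp only [Finset.mem_coe, mem_descFns, mem_parentFns] at hx ⊢
    refine ⟨fun w hw => if_neg hw, ?_, ?_, ?_, by simp, ?_⟩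
    · intro g hg
      obtain ⟨g', hg', rfl⟩ := Finset.mem_image.1 hg
      have := hx.jumps g' hg'
      omega
    · intro w hw hw'
      have := hx.bounds (a + b - w) (by omega) (by omega)
      have := hx.asc rfl (a + b - w) (by omega) (by omega)
      simp only [hw, hw', and_self, if_true]
      omega
    · intro x y h1 h2 h3 h4
      have := hx.bounds (a + b - x) (by omega) (by omega)
      have := hx.bounds (a + b - y) (by omega) (by omega)
      have := hx.nc (a + b - y) (a + b - x) (by omega) (by omega) (by omega) (by omega)
      simp only [h1, h2, h3, h4, and_self, if_true]
      unfold NotCrossing at *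
      omega
    · intro x h1 h2
      have := hx.bounds (a + b - x) (by omega) (by omega)
      have := hx.asc rfl (a + b - x) (by omega) (by omega)
      obtain ⟨g, hg, hg'⟩ := hx.jump (a + b - x) (by omega) (by omega)
      simp only [h1, h2, and_self, if_true]
      exact ⟨a + b - 1 - g, Finset.mem_image_of_mem _ hg, by omega⟩
  · rintro ⟨p, B⟩ hx
    simp only [Finset.mem_coe, mem_descFns] at hx
    refine Prod.ext (funext fun w => ?_) ?_
    · by_cases hw : a ≤ w ∧ w < b
      · have := hx.bounds w hw.1 hw.2
        have h1 : a + b - (a + b - w) = w := by omega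
        have h2 : a < a + b - w ∧ a + b - w ≤ b := by omega
        simp only [hw, h2, h1, and_self, if_true]
        omega
      · simp only [if_neg hw, hx.out w hw]
    · simp only [Finset.image_image]
      refine (Finset.image_congr (g := id) ?_).trans Finset.image_id
      intro g hg
      have := hx.jumps g hg
      simp only [Function.comp, id]
      omega
  · rintro ⟨p, B⟩ hx
    simp only [Finset.mem_coe, mem_parentFns] at hx
    refine Prod.ext (funext fun w => ?_) ?_
    · by_cases hw : a < w ∧ w ≤ b
      · have := hx.bounds w hw.1 hw.2
        have h1 : a + b - (a + b - w) = w := by omega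
        have h2 : a ≤ a + b - w ∧ a + b - w < b := by omega
        simp only [hw, h2, h1, and_self, if_true]
        omega
      · simp only [if_neg hw, hx.out w hw]
    · simp only [Finset.image_image]
      refine (Finset.image_congr (g := id) ?_).trans Finset.image_id
      intro g hg
      have := hx.jumps g hg
      simp only [Function.comp, id]
      omega

/-- Translation invariance follows from the recurrence and the initial value, without translating
any function. -/
theorem card_parentFns_false_add (n : ℕ) :
    ∀ a, (parentFns false a (a + n)).card = (parentFns false 0 n).card := by
  induction n using Nat.strong_induction_on with
  | _ n ih =>
    intro a
    rcases n with _ | n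
    · rw [add_zero, card_parentFns_self, card_parentFns_self]
    · conv_rhs => rw [← zero_add (n + 1)]
      rw [card_parentFns_succ, card_parentFns_succ]
      refine Finset.sum_congr rfl fun x hx => Finset.sum_congr rfl fun y hy => ?_
      rw [Finset.HasAntidiagonal.mem_antidiagonal] at hx hy
      rw [card_descFns_false, card_descFns_false, ih x.1 (by omega), ih y.2 (by omega),
        ih x.1 (by omega), ih y.2 (by omega)]

theorem card_parentFns_true_add (n : ℕ) :
    ∀ a, (parentFns true a (a + n)).card = (parentFns true 0 n).card := by
  induction n using Nat.strong_induction_on with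
  | _ n ih =>
    intro a
    rcases n with _ | n
    · rw [add_zero, card_parentFns_self, card_parentFns_self]
    · conv_rhs => rw [← zero_add (n + 1)]
      rw [card_parentFns_succ, card_parentFns_succ]
      refine Finset.sum_congr rfl fun x hx => Finset.sum_congr rfl fun y hy => ?_
      rw [Finset.HasAntidiagonal.mem_antidiagonal] at hx hy
      rw [card_descFns_true, card_descFns_true, card_parentFns_false_add,
        card_parentFns_false_add, ih x.1 (by omega), ih y.2 (by omega),
        ih x.1 (by omega), ih y.2 (by omega)]

/-! ### Quadratic equations for the generating functions -/

open PowerSeries in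
/-- The generating function of the numbers of parent functions. -/
noncomputable def parentSeries (e : Bool) : PowerSeries ℚ :=
  PowerSeries.mk fun n => ((parentFns e 0 n).card : ℚ)

open PowerSeries in
-- Weight 2 throughout would give 2GHG. This counts the term with both indices 0 once too often, and
-- that term is `g n` because `g 0 = h 0 = 1`.
theorem eq_of_recurrence {g h : ℕ → ℚ} (h0 : h 0 = 1) (g0 : g 0 = 1)
    (hg : ∀ n, g (n + 1) = ∑ x ∈ Finset.HasAntidiagonal.antidiagonal n, ∑ y ∈ Finset.HasAntidiagonal.antidiagonal x.2,
      (if x.1 = 0 ∧ y.1 = 0 then 1 else 2) * (g x.1 * (h y.1 * g y.2))) :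
    PowerSeries.mk g = 1 + X * (2 * PowerSeries.mk g * PowerSeries.mk h * PowerSeries.mk g -
      PowerSeries.mk g) := by
  ext n
  rcases n with _ | n
  · simp [g0]
  · have h2 : (2 : PowerSeries ℚ) = PowerSeries.C (2 : ℚ) := (map_ofNat PowerSeries.C 2).symm
    rw [map_add, coeff_succ_X_mul, coeff_mk, coeff_one, if_neg n.succ_ne_zero, zero_add, map_sub,
      coeff_mk, mul_assoc, mul_assoc, h2, coeff_C_mul, coeff_mul, hg, Finset.mul_sum,
      eq_sub_iff_add_eq]
    have h3 : g n = ∑ x ∈ Finset.HasAntidiagonal.antidiagonal n, ∑ y ∈ Finset.HasAntidiagonal.antidiagonal x.2,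
        (if x.1 = 0 ∧ y.1 = 0 then 1 else 0) * (g x.1 * (h y.1 * g y.2)) := by
      rw [Finset.sum_eq_single (0, n), Finset.sum_eq_single (0, n)]
      · simp [g0, h0]
      · rintro ⟨i, j⟩ hij hne
        rw [Finset.HasAntidiagonal.mem_antidiagonal] at hij
        simp only [ne_eq, Prod.mk.injEq] at hne hij
        rw [if_neg (by simp only; omega), zero_mul]
      · simp
      · rintro ⟨i, j⟩ hij hne
        rw [Finset.HasAntidiagonal.mem_antidiagonal] at hij
        simp only [ne_eq, Prod.mk.injEq] at hne hij
        refine Finset.sum_eq_zero fun y _ => ?_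
        rw [if_neg (by simp only; omega), zero_mul]
      · simp
    conv_lhs => rw [h3]
    rw [← Finset.sum_add_distrib]
    refine Finset.sum_congr rfl fun x _ => ?_
    rw [← Finset.sum_add_distrib, coeff_mul, Finset.mul_sum, Finset.mul_sum]
    refine Finset.sum_congr rfl fun y _ => ?_
    simp only [coeff_mk]
    split_ifs <;> ring

open PowerSeries in
theorem parentSeries_false :
    parentSeries false = 1 + X * (2 * parentSeries false * parentSeries false -
      parentSeries false) := by
  have h1 : (PowerSeries.mk fun j : ℕ => if j = 0 then (1 : ℚ) else 0) = 1 := by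
    ext n
    rw [coeff_mk, coeff_one]
  have := eq_of_recurrence (g := fun n => ((parentFns false 0 n).card : ℚ))
    (h := fun j => if j = 0 then 1 else 0) (by simp) (by simp [card_parentFns_self]) ?_
  · rw [h1, mul_one] at this
    exact this
  · intro n
    have := card_parentFns_succ false 0 n
    simp only [card_descFns_false, card_parentFns_false_add, zero_add] at this
    rw [this]
    push_cast
    rfl

open PowerSeries in
theorem parentSeries_true :
    parentSeries true = 1 + X * (2 * parentSeries true * parentSeries false * parentSeries true -
      parentSeries true) := by
  refine eq_of_recurrence (g := fun n => ((parentFns true 0 n).card : ℚ))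
    (h := fun n => ((parentFns false 0 n).card : ℚ)) (by simp [card_parentFns_self])
    (by simp [card_parentFns_self]) ?_
  intro n
  have := card_parentFns_succ true 0 n
  simp only [card_descFns_true, card_parentFns_false_add, card_parentFns_true_add, zero_add] at this
  rw [this]
  push_cast
  rfl

/-! ### From trees to pairs of a parent function and a jump set -/

namespace GNCTree

variable {n : ℕ}

/-- The path from the root to a vertex. -/
noncomputable def rootPath (T : GNCTree n) (w : Fin (n + 1)) : T.graph.Walk 0 w :=
  (T.isTree.existsUnique_path 0 w).choose

theorem rootPath_isPath (T : GNCTree n) (w : Fin (n + 1)) : (T.rootPath w).IsPath :=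
  (T.isTree.existsUnique_path 0 w).choose_spec.1

theorem eq_rootPath (T : GNCTree n) {w : Fin (n + 1)} {p : T.graph.Walk 0 w} (hp : p.IsPath) :
    p = T.rootPath w :=
  (T.isTree.existsUnique_path 0 w).choose_spec.2 p hp

theorem rootPath_zero (T : GNCTree n) : T.rootPath 0 = SimpleGraph.Walk.nil :=
  (T.eq_rootPath SimpleGraph.Walk.IsPath.nil).symm

/-- The parent of a vertex; the root is its own parent. -/
noncomputable def parent (T : GNCTree n) (w : Fin (n + 1)) : Fin (n + 1) :=
  (T.rootPath w).penultimate

theorem isChild_iff (T : GNCTree n) {v w : Fin (n + 1)} :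
    T.IsChild v w ↔ w ≠ 0 ∧ T.parent w = v := by
  constructor
  · rintro ⟨hadj, p, hp, hv⟩
    rw [T.eq_rootPath hp] at hv
    refine ⟨?_, (T.isTree.isAcyclic.eq_penultimate_of_adj_end (T.rootPath_isPath w)
      hadj.symm hv).symm⟩
    rintro rfl
    rw [rootPath_zero, SimpleGraph.Walk.support_nil, List.mem_singleton] at hv
    exact hadj.ne hv
  · rintro ⟨hw, rfl⟩
    exact ⟨(T.rootPath w).adj_penultimate (SimpleGraph.Walk.not_nil_of_ne hw.symm), T.rootPath w,
      T.rootPath_isPath w, (T.rootPath w).getVert_mem_support _⟩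

theorem adj_iff (T : GNCTree n) {v w : Fin (n + 1)} :
    T.graph.Adj v w ↔ T.IsChild v w ∨ T.IsChild w v := by
  refine ⟨fun h => ?_, fun h => h.elim (fun h => h.1) fun h => h.1.symm⟩
  obtain ⟨p, hp, -⟩ := T.isTree.existsUnique_path 0 v
  obtain ⟨q, hq, -⟩ := T.isTree.existsUnique_path 0 w
  by_cases hv : v ∈ q.support
  · exact Or.inl ⟨h, q, hq, hv⟩
  · exact Or.inr ⟨h.symm, p, hp,
      T.isTree.isAcyclic.mem_support_of_ne_mem_support_of_adj_of_isPath hp hq h hv⟩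

theorem adj_parent (T : GNCTree n) {w : Fin (n + 1)} (hw : w ≠ 0) :
    T.graph.Adj (T.parent w) w :=
  (T.isChild_iff.2 ⟨hw, rfl⟩).1

theorem parent_zero (T : GNCTree n) : T.parent 0 = 0 := by
  rw [parent, rootPath_zero]
  rfl

/-- The parent function of a tree, as a function on the natural numbers. -/
noncomputable def parentNat (T : GNCTree n) (w : ℕ) : ℕ :=
  if h : w < n + 1 then T.parent ⟨w, h⟩ else 0

/-- The gaps at which the label of a tree jumps. -/
def jumps (T : GNCTree n) : Finset ℕ :=
  (Finset.univ.filter fun g : Fin n => T.label g.castSucc < T.label g.succ).map Fin.valEmbedding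

theorem parentNat_val (T : GNCTree n) (w : Fin (n + 1)) : T.parentNat w = T.parent w := by
  rw [parentNat, dif_pos w.2]

theorem mem_jumps (T : GNCTree n) {g : ℕ} :
    g ∈ T.jumps ↔ ∃ h : g < n, T.label (Fin.castSucc ⟨g, h⟩) < T.label (Fin.succ ⟨g, h⟩) := by
  simp only [jumps, Finset.mem_map, Finset.mem_filter, Finset.mem_univ, true_and,
    Fin.valEmbedding_apply]
  constructor
  · rintro ⟨g, hg, rfl⟩
    exact ⟨g.2, hg⟩
  · rintro ⟨h, hg⟩
    exact ⟨⟨g, h⟩, hg, rfl⟩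

theorem label_zero (T : GNCTree n) : T.label 0 = 1 := by
  obtain ⟨w, hw⟩ := T.exists_label_eq 0 1 le_rfl (T.one_le_label 0)
  have := T.label_mono (Fin.zero_le w)
  have := T.one_le_label 0
  omega

/-- By monotonicity, a value skipped between consecutive points would be the label of no point. -/
theorem label_succ_le (T : GNCTree n) (g : Fin n) : T.label g.succ ≤ T.label g.castSucc + 1 := by
  by_contra hlt
  obtain ⟨w, hw⟩ := T.exists_label_eq g.succ (T.label g.castSucc + 1) (by omega) (by omega)
  rcases le_or_gt w g.castSucc with h | h
  · have := T.label_mono h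
    omega
  · have := T.label_mono (Fin.castSucc_lt_iff_succ_le.1 h)
    omega

/-- The label of a vertex, given the set of jumps. -/
def labelOfJumps (B : Finset ℕ) (i : ℕ) : ℕ :=
  1 + ∑ g ∈ Finset.range i, if g ∈ B then 1 else 0

theorem labelOfJumps_succ (B : Finset ℕ) (i : ℕ) :
    labelOfJumps B (i + 1) = labelOfJumps B i + if i ∈ B then 1 else 0 := by
  rw [labelOfJumps, Finset.sum_range_succ, labelOfJumps, add_assoc]

theorem labelOfJumps_mono (B : Finset ℕ) : Monotone (labelOfJumps B) :=
  monotone_nat_of_le_succ fun i => by rw [labelOfJumps_succ]; omega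

theorem labelOfJumps_lt_iff (B : Finset ℕ) {i j : ℕ} :
    labelOfJumps B i < labelOfJumps B j ↔ ∃ g ∈ B, i ≤ g ∧ g < j := by
  induction j with
  | zero =>
    have := labelOfJumps_mono B (Nat.zero_le i)
    simp only [Nat.not_lt_zero, and_false, exists_false, iff_false]
    omega
  | succ j ih =>
    rw [labelOfJumps_succ]
    constructor
    · intro h
      by_cases hij : i ≤ j
      · by_cases hj : j ∈ B
        · exact ⟨j, hj, hij, by omega⟩
        · rw [if_neg hj, add_zero, ih] at h
          obtain ⟨g, hg, h1, h2⟩ := h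
          exact ⟨g, hg, h1, by omega⟩
      · have := labelOfJumps_mono B (show j + 1 ≤ i by omega)
        rw [labelOfJumps_succ] at this
        omega
    · rintro ⟨g, hg, h1, h2⟩
      rcases eq_or_lt_of_le (Nat.lt_succ_iff.1 h2) with rfl | h3
      · have := labelOfJumps_mono B h1
        rw [if_pos hg]
        omega
      · have := ih.2 ⟨g, hg, h1, h3⟩
        omega

theorem label_eq_labelOfJumps (T : GNCTree n) (v : Fin (n + 1)) :
    T.label v = labelOfJumps T.jumps v := by
  induction v using Fin.induction with
  | zero => simp [labelOfJumps, label_zero]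
  | succ g ih =>
    have h1 := T.label_succ_le g
    have h2 := T.label_mono (Fin.castSucc_lt_succ (i := g)).le
    have h3 : (g : ℕ) ∈ T.jumps ↔ T.label g.castSucc < T.label g.succ := by
      rw [mem_jumps]
      exact ⟨fun ⟨_, h⟩ => h, fun h => ⟨g.2, h⟩⟩
    rw [Fin.val_succ, labelOfJumps_succ, ← Fin.val_castSucc, ← ih]
    split_ifs with h
    · rw [Fin.val_castSucc, h3] at h
      omega
    · rw [Fin.val_castSucc, h3] at h
      omega

theorem parentNat_jumps_injective {S T : GNCTree n} (hp : S.parentNat = T.parentNat)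
    (hB : S.jumps = T.jumps) : S = T := by
  have hpar : S.parent = T.parent := by
    funext w
    rw [Fin.ext_iff, ← parentNat_val, ← parentNat_val, hp]
  refine GNCTree.ext (SimpleGraph.ext ?_) ?_
  · funext v w
    rw [eq_iff_iff, adj_iff, adj_iff, isChild_iff, isChild_iff, isChild_iff, isChild_iff, hpar]
  · funext v
    rw [label_eq_labelOfJumps, label_eq_labelOfJumps, hB]

theorem contains_singleton_iff (T : GNCTree n) (s : GNCStep) :
    T.Contains [s] ↔ ∃ w, w ≠ 0 ∧ GNCStep.ofLabels (T.label (T.parent w)) (T.label w) = s := by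
  constructor
  · rintro ⟨l, hl, hw⟩
    rcases l with _ | ⟨v, _ | ⟨w, _ | ⟨x, l⟩⟩⟩
    · simp [word] at hw
    · simp [word] at hw
    · simp only [List.isChain_cons_cons, List.isChain_singleton, and_true] at hl
      obtain ⟨h, rfl⟩ := T.isChild_iff.1 hl
      simp only [word, List.cons.injEq, and_true] at hw
      exact ⟨w, h, hw⟩
    · simp [word] at hw
  · rintro ⟨w, hw, hs⟩
    exact ⟨[T.parent w, w], by simpa using T.isChild_iff.2 ⟨hw, rfl⟩, by simp [word, hs]⟩

theorem contains_pair_iff (T : GNCTree n) (s t : GNCStep) :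
    T.Contains [s, t] ↔ ∃ w, w ≠ 0 ∧ T.parent w ≠ 0 ∧
      GNCStep.ofLabels (T.label (T.parent (T.parent w))) (T.label (T.parent w)) = s ∧
      GNCStep.ofLabels (T.label (T.parent w)) (T.label w) = t := by
  constructor
  · rintro ⟨l, hl, hw⟩
    rcases l with _ | ⟨v, _ | ⟨w, _ | ⟨x, _ | ⟨y, l⟩⟩⟩⟩
    · simp [word] at hw
    · simp [word] at hw
    · simp [word] at hw
    · simp only [List.isChain_cons_cons, List.isChain_singleton, and_true] at hl
      obtain ⟨h2, rfl⟩ := T.isChild_iff.1 hl.2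
      obtain ⟨h1, rfl⟩ := T.isChild_iff.1 hl.1
      simp only [word, List.cons.injEq, and_true] at hw
      exact ⟨x, h2, h1, hw⟩
    · simp [word] at hw
  · rintro ⟨w, hw, hw', hs, ht⟩
    refine ⟨[T.parent (T.parent w), T.parent w, w], ?_, by simp [word, hs, ht]⟩
    simpa using ⟨T.isChild_iff.2 ⟨hw', rfl⟩, T.isChild_iff.2 ⟨hw, rfl⟩⟩

theorem ofLabels_eq_u {a b : ℕ} : GNCStep.ofLabels a b = GNCStep.u ↔ a < b := by
  unfold GNCStep.ofLabels
  split_ifs <;> simp_all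

theorem ofLabels_eq_h {a b : ℕ} : GNCStep.ofLabels a b = GNCStep.h ↔ a = b := by
  unfold GNCStep.ofLabels
  split_ifs <;> simp_all
  omega

theorem ofLabels_eq_d {a b : ℕ} : GNCStep.ofLabels a b = GNCStep.d ↔ b < a := by
  unfold GNCStep.ofLabels
  split_ifs <;> simp_all <;> omega

theorem lt_of_label_lt (T : GNCTree n) {v w : Fin (n + 1)} (h : T.label v < T.label w) : v < w :=
  T.label_mono.reflect_lt h

theorem notCrossing_parentNat (T : GNCTree n) {x y : Fin (n + 1)} (hx : x ≠ 0) (hy : y ≠ 0) :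
    NotCrossing x (T.parent x) y (T.parent y) := by
  rintro ⟨h1, h2, h3⟩
  have ax := T.adj_parent hx
  have ay := T.adj_parent hy
  rcases lt_or_gt_of_ne ax.ne with hx' | hx' <;> rcases lt_or_gt_of_ne ay.ne with hy' | hy'
  · exact T.nonCrossing (T.parent x) (T.parent y) x y (by omega) (by omega) (by omega) ax ay
  · exact T.nonCrossing (T.parent x) y x (T.parent y) (by omega) (by omega) (by omega) ax ay.symm
  · exact T.nonCrossing x (T.parent y) (T.parent x) y (by omega) (by omega) (by omega) ax.symm ay
  · exact T.nonCrossing x y (T.parent x) (T.parent y) (by omega) (by omega) (by omega)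
      ax.symm ay.symm

theorem isParentFn_iff (T : GNCTree n) (e : Bool) :
    IsParentFn e 0 n T.parentNat T.jumps ↔
      (∀ w, w ≠ 0 → T.label (T.parent w) ≠ T.label w) ∧
      (∀ w, w ≠ 0 → T.parent w ≠ 0 → T.parent w < T.parent (T.parent w) → w < T.parent w) ∧
      (e = false → ∀ w, w ≠ 0 → T.parent w < w) := by
  have hpos : ∀ w : Fin (n + 1), w ≠ 0 ↔ 0 < (w : ℕ) := fun w => by
    rw [Nat.pos_iff_ne_zero, ne_eq, ne_eq, Fin.ext_iff, Fin.val_zero]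
  have hforall : ∀ P : ℕ → Prop,
      (∀ x, 0 < x → x ≤ n → P x) ↔ ∀ w : Fin (n + 1), w ≠ 0 → P w := fun P =>
    ⟨fun h w hw => h w ((hpos w).1 hw) (Nat.lt_succ_iff.1 w.2),
      fun h x hx hx' => h ⟨x, Nat.lt_succ_of_le hx'⟩ ((hpos _).2 hx)⟩
  have hjump : ∀ w : Fin (n + 1), (∃ g ∈ T.jumps, min (w : ℕ) (T.parent w) ≤ g ∧
      g < max (w : ℕ) (T.parent w)) ↔ T.label (T.parent w) ≠ T.label w := by
    intro w
    rw [← labelOfJumps_lt_iff]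
    rcases le_total (w : ℕ) (T.parent w) with h | h
    · rw [min_eq_left h, max_eq_right h, ← label_eq_labelOfJumps, ← label_eq_labelOfJumps]
      have := T.label_mono h
      omega
    · rw [min_eq_right h, max_eq_left h, ← label_eq_labelOfJumps, ← label_eq_labelOfJumps]
      have := T.label_mono h
      omega
  constructor
  · intro h
    refine ⟨?_, ?_, ?_⟩
    · intro w hw
      have := (hforall _).1 h.jump w hw
      rw [parentNat_val, hjump] at this
      exact this
    · intro w hw hw' hlt
      have := (hforall _).1 h.desc w hw
      rw [parentNat_val, parentNat_val] at this
      exact this ((hpos _).1 hw') hlt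
    · intro he w hw
      have := (hforall _).1 (h.asc he) w hw
      rw [parentNat_val] at this
      exact this
  · rintro ⟨h1, h2, h3⟩
    refine ⟨?_, ?_, ?_, ?_, ?_, fun he => ?_, ?_⟩
    · intro w hw
      unfold parentNat
      split_ifs with h
      · have : (⟨w, h⟩ : Fin (n + 1)) = 0 := Fin.ext (by simp; omega)
        rw [this, parent_zero, Fin.val_zero]
      · rfl
    · intro g hg
      exact ⟨Nat.zero_le _, (T.mem_jumps.1 hg).1⟩
    · rw [hforall]
      intro w hw
      rw [parentNat_val]
      exact ⟨Nat.zero_le _, Nat.lt_succ_iff.1 (T.parent w).2,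
        fun h => (T.adj_parent hw).ne (Fin.ext h)⟩
    · intro x y hx hx' hy hy'
      have := T.notCrossing_parentNat (x := ⟨x, Nat.lt_succ_of_le hx'⟩)
        (y := ⟨y, Nat.lt_succ_of_le hy'⟩) ((hpos _).2 hx) ((hpos _).2 hy)
      rwa [← parentNat_val, ← parentNat_val] at this
    · rw [hforall]
      intro w hw
      rw [parentNat_val, parentNat_val]
      exact fun h h' => h2 w hw ((hpos _).2 h) h'
    · rw [hforall]
      intro w hw
      rw [parentNat_val]
      exact h3 he w hw
    · rw [hforall]
      intro w hw
      rw [parentNat_val, hjump]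
      exact h1 w hw

theorem mem_avoiding_pair (T : GNCTree n) (σ τ : List GNCStep) :
    T ∈ avoiding n {σ, τ} ↔ ¬ T.Contains σ ∧ ¬ T.Contains τ := by
  simp [avoiding]

theorem mem_avoiding_ud_h (T : GNCTree n) :
    T ∈ avoiding n {[GNCStep.u, GNCStep.d], [GNCStep.h]} ↔
      IsParentFn false 0 n T.parentNat T.jumps := by
  rw [mem_avoiding_pair, contains_pair_iff, contains_singleton_iff, isParentFn_iff]
  simp only [ofLabels_eq_u, ofLabels_eq_d, ofLabels_eq_h, not_exists, not_and, ne_eq]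
  constructor
  · rintro ⟨h1, h2⟩
    -- Induction from the right end: a left edge to `w` starts at a vertex further right, which is
    -- reached by a right edge by induction, and this gives `ud`.
    have hasc : ∀ k, ∀ w : Fin (n + 1), n - w = k → w ≠ 0 → T.parent w < w := by
      intro k
      induction k using Nat.strong_induction_on with
      | _ k ih =>
        intro w hk hw
        by_contra hlt
        have hne := (T.adj_parent hw).ne
        have hlt' : w < T.parent w := by omega
        have hp0 : T.parent w ≠ 0 := (lt_of_le_of_lt (Fin.zero_le w) hlt').ne'
        have := ih (n - T.parent w) (by omega) (T.parent w) rfl hp0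
        refine h1 w hw hp0 ?_ ?_
        · exact lt_of_le_of_ne (T.label_mono this.le) (h2 _ hp0)
        · exact lt_of_le_of_ne (T.label_mono hlt'.le) (Ne.symm (h2 _ hw))
    refine ⟨h2, fun w hw hw' h => ?_, fun _ w hw => hasc _ w rfl hw⟩
    exact absurd h (hasc _ _ rfl hw').not_gt
  · rintro ⟨h1, -, h3⟩
    refine ⟨fun w hw hw' _ hd => ?_, h1⟩
    exact (h3 trivial w hw).not_gt (T.lt_of_label_lt hd)

theorem mem_avoiding_du_h (T : GNCTree n) :
    T ∈ avoiding n {[GNCStep.d, GNCStep.u], [GNCStep.h]} ↔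
      IsParentFn true 0 n T.parentNat T.jumps := by
  rw [mem_avoiding_pair, contains_pair_iff, contains_singleton_iff, isParentFn_iff]
  simp only [ofLabels_eq_u, ofLabels_eq_d, ofLabels_eq_h, not_exists, not_and, ne_eq]
  constructor
  · rintro ⟨h1, h2⟩
    refine ⟨h2, fun w hw hw' h => ?_, by simp⟩
    by_contra hlt
    have hne := (T.adj_parent hw).ne
    have hlt' : T.parent w < w := by omega
    refine h1 w hw hw' ?_ ?_
    · exact lt_of_le_of_ne (T.label_mono h.le) (Ne.symm (h2 _ hw'))
    · exact lt_of_le_of_ne (T.label_mono hlt'.le) (h2 _ hw)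
  · rintro ⟨h1, h2, -⟩
    refine ⟨fun w hw hw' hd hu => ?_, h1⟩
    exact (h2 w hw hw' (T.lt_of_label_lt hd)).not_gt (T.lt_of_label_lt hu)

end GNCTree

/-! ### The tree of a parent function with decreasing rank -/

section RootedTree

variable {V : Type*} (r : V) (par : V → V) (rk : V → ℕ)

/-- The graph in which every vertex other than `r` is joined to its parent. -/
def parentGraph : SimpleGraph V :=
  SimpleGraph.fromRel fun v w => w ≠ r ∧ par w = v

variable {r par rk}

theorem parentGraph_adj (h : ∀ w, w ≠ r → rk (par w) < rk w) {w : V} (hw : w ≠ r) :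
    (parentGraph r par).Adj (par w) w := by
  rw [parentGraph, SimpleGraph.fromRel_adj]
  exact ⟨fun he => (h w hw).ne (by rw [he]), Or.inl ⟨hw, rfl⟩⟩

/-- The rank bound on the support is what keeps the walk a path when the next vertex is appended. -/
theorem exists_path_parentGraph (h : ∀ w, w ≠ r → rk (par w) < rk w) (w : V) :
    ∃ q : (parentGraph r par).Walk r w, q.IsPath ∧ (∀ v ∈ q.support, rk v ≤ rk w) ∧
      (w ≠ r → par w ∈ q.support) := by
  induction hk : rk w using Nat.strong_induction_on generalizing w with
  | _ k ih =>
    by_cases hw : w = r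
    · subst hw
      exact ⟨SimpleGraph.Walk.nil, SimpleGraph.Walk.IsPath.nil, by simp [hk], by simp⟩
    · have hlt := h w hw
      obtain ⟨q, hq, hr, -⟩ := ih (rk (par w)) (hk ▸ hlt) (par w) rfl
      refine ⟨q.concat (parentGraph_adj h hw), hq.concat (fun hmem => ?_) _, ?_, fun _ => ?_⟩
      · exact (hr w hmem).not_gt hlt
      · intro v hv
        rw [SimpleGraph.Walk.support_concat, List.mem_append] at hv
        rcases hv with hv | hv
        · exact (hr v hv).trans (hk ▸ hlt.le)
        · rw [List.mem_singleton.1 hv, hk]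
      · rw [SimpleGraph.Walk.support_concat, List.mem_append]
        exact Or.inl q.end_mem_support

/-- Every vertex is linked to `r`, and each edge comes from a vertex other than `r`, so there are at
most `|V| - 1` edges. -/
theorem isTree_parentGraph [Fintype V] (h : ∀ w, w ≠ r → rk (par w) < rk w) :
    (parentGraph r par).IsTree := by
  classical
  have hreach : ∀ w, (parentGraph r par).Reachable r w := fun w =>
    ⟨(exists_path_parentGraph h w).choose⟩
  have hconn : (parentGraph r par).Connected :=
    { preconnected := fun v w => (hreach v).symm.trans (hreach w), nonempty := ⟨r⟩ }
  rw [SimpleGraph.isTree_iff_connected_and_card]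
  refine ⟨hconn, le_antisymm ?_ hconn.card_vert_le_card_edgeSet_add_one⟩
  have hsub : (parentGraph r par).edgeSet ⊆
      ((Finset.univ.erase r).image fun w => s(par w, w) : Finset (Sym2 V)) := by
    intro x
    induction x using Sym2.ind with
    | _ v w =>
      rw [SimpleGraph.mem_edgeSet, parentGraph, SimpleGraph.fromRel_adj]
      simp only [Finset.coe_image, Set.mem_image, Finset.mem_coe, Finset.mem_erase,
        Finset.mem_univ, and_true]
      rintro ⟨-, ⟨hw, rfl⟩ | ⟨hv, rfl⟩⟩
      · exact ⟨w, hw, rfl⟩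
      · exact ⟨v, hv, Sym2.eq_swap⟩
  have h1 : Nat.card (parentGraph r par).edgeSet ≤ _ := Set.ncard_le_ncard hsub
  rw [Set.ncard_coe_finset] at h1
  have h2 := h1.trans Finset.card_image_le
  rw [Finset.card_erase_of_mem (Finset.mem_univ r), Finset.card_univ] at h2
  have : 0 < Fintype.card V := Fintype.card_pos_iff.2 ⟨r⟩
  rw [Nat.card_eq_fintype_card (α := V)]
  omega

end RootedTree

/-! ### Every pair comes from a tree -/

namespace GNCTree

variable {n : ℕ}

theorem exists_labelOfJumps_eq (B : Finset ℕ) (k i : ℕ) (hi : 1 ≤ i)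
    (hik : i ≤ labelOfJumps B k) : ∃ w ≤ k, labelOfJumps B w = i := by
  induction k with
  | zero =>
    simp only [labelOfJumps, Finset.range_zero, Finset.sum_empty] at hik
    exact ⟨0, le_rfl, by simp [labelOfJumps]; omega⟩
  | succ k ih =>
    by_cases h : i ≤ labelOfJumps B k
    · obtain ⟨w, hw, rfl⟩ := ih h
      exact ⟨w, by omega, rfl⟩
    · refine ⟨k + 1, le_rfl, ?_⟩
      rw [labelOfJumps_succ] at hik ⊢
      split_ifs at hik ⊢ <;> omega

theorem exists_tree_of_isParentFn {e : Bool} {p : ℕ → ℕ} {B : Finset ℕ}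
    (h : IsParentFn e 0 n p B) : ∃ T : GNCTree n, T.parentNat = p ∧ T.jumps = B := by
  have hle : ∀ w, p w ≤ n := fun w => by
    by_cases hw : 0 < w ∧ w ≤ n
    · exact (h.bounds w hw.1 hw.2).2.1
    · simp [h.out w hw]
  let par : Fin (n + 1) → Fin (n + 1) := fun w => ⟨p w, Nat.lt_succ_of_le (hle w)⟩
  -- A path from the root makes right edges, along which positions grow, and then left edges, along
  -- which they shrink. The offset `n + 1` ranks the second phase above the first.
  let rk : Fin (n + 1) → ℕ := fun w => if w < p w then n + 1 + (n - w) else w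
  have hne0 : ∀ w : Fin (n + 1), w ≠ 0 → 0 < (w : ℕ) ∧ (w : ℕ) ≤ n := fun w hw => by
    rw [ne_eq, Fin.ext_iff, Fin.val_zero] at hw
    omega
  have hrk : ∀ w, w ≠ 0 → rk (par w) < rk w := by
    intro w hw
    obtain ⟨h1, h2⟩ := hne0 w hw
    have h3 := h.bounds w h1 h2
    have h4 := h.desc w h1 h2
    have h5 := h.out 0 (by omega)
    simp only [rk, par]
    by_cases hp0 : p w = 0
    · rw [hp0, h5]
      split_ifs <;> omega
    · have := hle (p w)
      have h6 := h4 (by omega)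
      split_ifs with h7 h8 h8
      · omega
      · have := h6 h7
        omega
      · omega
      · omega
  have hadj : ∀ {v w : Fin (n + 1)}, (parentGraph 0 par).Adj v w →
      (0 < (w : ℕ) ∧ p w = v) ∨ (0 < (v : ℕ) ∧ p v = w) := by
    intro v w hvw
    rw [parentGraph, SimpleGraph.fromRel_adj] at hvw
    rcases hvw with ⟨-, ⟨hw, rfl⟩ | ⟨hv, rfl⟩⟩
    · exact Or.inl ⟨(hne0 w hw).1, rfl⟩
    · exact Or.inr ⟨(hne0 v hv).1, rfl⟩
  let T : GNCTree n :=
    { graph := parentGraph 0 par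
      label := fun v => labelOfJumps B v
      isTree := isTree_parentGraph hrk
      nonCrossing := by
        intro a b c d hab hbc hcd hac hbd
        rw [Fin.lt_def] at hab hbc hcd
        have := a.2
        have := b.2
        have := c.2
        have := d.2
        rcases hadj hac with ⟨h1, h2⟩ | ⟨h1, h2⟩ <;> rcases hadj hbd with ⟨h3, h4⟩ | ⟨h3, h4⟩ <;>
        · have nc := h.nc _ _ h1 (by omega) h3 (by omega)
          rw [h2, h4] at nc
          unfold NotCrossing at nc
          omega
      one_le_label := fun v => by simp [labelOfJumps]
      label_mono := fun v w hvw => labelOfJumps_mono B hvw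
      exists_label_eq := fun v i hi hiv => by
        obtain ⟨w, hw, rfl⟩ := exists_labelOfJumps_eq B v i hi hiv
        exact ⟨⟨w, lt_of_le_of_lt hw v.2⟩, rfl⟩ }
  have hpar : ∀ w, w ≠ 0 → T.parent w = par w := by
    intro w hw
    obtain ⟨q, hq, -, hmem⟩ := exists_path_parentGraph hrk w
    have hc : T.IsChild (par w) w := ⟨parentGraph_adj hrk hw, q, hq, hmem hw⟩
    exact (T.isChild_iff.1 hc).2
  refine ⟨T, ?_, ?_⟩
  · funext w
    rw [parentNat]
    split_ifs with hw
    · by_cases hw0 : (⟨w, hw⟩ : Fin (n + 1)) = 0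
      · rw [hw0, parent_zero, Fin.val_zero]
        rw [Fin.ext_iff, Fin.val_zero] at hw0
        exact (h.out w (by simp only at hw0; omega)).symm
      · rw [hpar _ hw0]
    · exact (h.out w (by omega)).symm
  · ext g
    rw [mem_jumps]
    constructor
    · rintro ⟨hg, hlt⟩
      change labelOfJumps B g < labelOfJumps B (g + 1) at hlt
      rw [labelOfJumps_succ] at hlt
      by_contra hgB
      simp [hgB] at hlt
    · intro hg
      refine ⟨(h.jumps g hg).2, ?_⟩
      change labelOfJumps B g < labelOfJumps B (g + 1)
      rw [labelOfJumps_succ, if_pos hg]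
      omega

theorem ncard_eq_card_parentFns (e : Bool) (s : Set (GNCTree n))
    (hs : ∀ T, T ∈ s ↔ IsParentFn e 0 n T.parentNat T.jumps) :
    s.ncard = (parentFns e 0 n).card := by
  rw [← Set.ncard_coe_finset]
  refine Set.ncard_congr (fun T _ => (T.parentNat, T.jumps)) ?_ ?_ ?_
  · intro T hT
    rw [Finset.mem_coe, mem_parentFns]
    exact (hs T).1 hT
  · intro S T _ _ hST
    rw [Prod.mk.injEq] at hST
    exact parentNat_jumps_injective hST.1 hST.2
  · rintro ⟨p, B⟩ hpB
    rw [Finset.mem_coe, mem_parentFns] at hpB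
    obtain ⟨T, rfl, rfl⟩ := exists_tree_of_isParentFn hpB
    exact ⟨T, (hs T).2 hpB, rfl⟩

end GNCTree

/-! ### Solving the equations and extracting coefficients -/

section Series

open PowerSeries Finset

/-- Since X divides `a`, the power `a ^ i` has no terms below degree `i`, so only `i ≤ n`
contribute. -/
theorem coeff_mul_subst {a : ℚ⟦X⟧} (ha : constantCoeff a = 0) (b f : ℚ⟦X⟧) (n : ℕ) :
    coeff n (b * f.subst a) = ∑ i ∈ range (n + 1), coeff i f * coeff n (b * a ^ i) := by
  have h1 : ∀ m ≤ n, coeff m (f.subst a) = ∑ i ∈ range (n + 1), coeff i f * coeff m (a ^ i) := by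
    intro m hm
    rw [coeff_subst' (HasSubst.of_constantCoeff_zero' ha)]
    simp only [smul_eq_mul]
    refine finsum_eq_sum_of_support_subset _ fun i hi => ?_
    rw [Finset.mem_coe, mem_range]
    by_contra hlt
    refine hi ?_
    obtain ⟨c, rfl⟩ := X_dvd_iff.2 ha
    simp only
    rw [mul_pow, coeff_X_pow_mul', if_neg (by omega), mul_zero]
  rw [coeff_mul]
  have h2 : ∀ x ∈ HasAntidiagonal.antidiagonal n, coeff x.1 b * coeff x.2 (f.subst a) =
      ∑ i ∈ range (n + 1), coeff i f * (coeff x.1 b * coeff x.2 (a ^ i)) := by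
    intro x hx
    rw [HasAntidiagonal.mem_antidiagonal] at hx
    rw [h1 x.2 (by omega), mul_sum]
    exact sum_congr rfl fun i _ => by ring
  rw [sum_congr rfl h2, sum_comm]
  exact sum_congr rfl fun i _ => by rw [coeff_mul, mul_sum]

/-- The generating function of the Catalan numbers with rational coefficients. -/
noncomputable def catalanRat : ℚ⟦X⟧ := catalanSeries.map (Nat.castRingHom ℚ)

theorem coeff_catalanRat (n : ℕ) : coeff n catalanRat = catalan n := by
  simp [catalanRat]

theorem catalanRat_eq : catalanRat = 1 + X * catalanRat ^ 2 := by
  have := congrArg (PowerSeries.map (Nat.castRingHom ℚ)) catalanSeries_sq_mul_X_add_one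
  rw [map_add, map_mul, map_pow, map_X, map_one] at this
  rw [catalanRat]
  conv_lhs => rw [← this]
  ring

theorem catalanRat_subst_eq {a : ℚ⟦X⟧} (ha : constantCoeff a = 0) :
    catalanRat.subst a = 1 + a * catalanRat.subst a ^ 2 := by
  have hs := HasSubst.of_constantCoeff_zero' ha
  conv_lhs => rw [catalanRat_eq]
  rw [← coe_substAlgHom hs, map_add, map_mul, map_pow, map_one, substAlgHom_X]

/-- This is the relation between coefficients that C^(i+1) = C^i + X C^(i+2) demands. -/
theorem gncRatio_rec (i j : ℕ) :
    gncRatio (i + 1) (j + 1) * ((2 * (j + 1) + (i + 1)).choose (j + 1) : ℚ) =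
      gncRatio i (j + 1) * ((2 * (j + 1) + i).choose (j + 1) : ℚ) +
        gncRatio (i + 2) j * ((2 * j + (i + 2)).choose j : ℚ) := by
  have e1 : 2 * (j + 1) + (i + 1) = (2 * j + i + 2) + 1 := by ring
  have e2 : 2 * (j + 1) + i = 2 * j + i + 2 := by ring
  have e3 : 2 * j + (i + 2) = 2 * j + i + 2 := by ring
  rw [e1, e2, e3, Nat.choose_succ_succ]
  have h := Nat.choose_succ_right_eq (2 * j + i + 2) j
  have e4 : 2 * j + i + 2 - j = j + i + 2 := by omega
  rw [e4] at h
  have hq : ((2 * j + i + 2).choose (j + 1) : ℚ) * (j + 1) =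
      (2 * j + i + 2).choose j * (j + i + 2) := by exact_mod_cast h
  have hj : (j : ℚ) + 1 ≠ 0 := by positivity
  rw [← eq_div_iff hj] at hq
  simp only [gncRatio, Nat.add_eq_zero_iff, one_ne_zero, and_false, false_and, if_false,
    OfNat.ofNat_ne_zero]
  push_cast
  rw [hq]
  have hN : 2 * ((j : ℚ) + 1) + (i + 1) ≠ 0 := by positivity
  have hN' : 2 * ((j : ℚ) + 1) + i ≠ 0 := by positivity
  have hN2 : 2 * (j : ℚ) + (i + 2) ≠ 0 := by positivity
  field_simp
  ring

theorem coeff_catalanRat_pow (j : ℕ) : ∀ i,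
    coeff j (catalanRat ^ i) = gncRatio i j * ((2 * j + i).choose j : ℚ) := by
  induction j with
  | zero =>
    intro i
    have h0 : constantCoeff catalanRat = 1 := by
      rw [← coeff_zero_eq_constantCoeff_apply, coeff_catalanRat, catalan_zero, Nat.cast_one]
    rw [coeff_zero_eq_constantCoeff_apply, map_pow, h0, one_pow]
    by_cases hi : i = 0
    · simp [gncRatio, hi]
    · have : (i : ℚ) ≠ 0 := by exact_mod_cast hi
      simp [gncRatio, hi]
  | succ j ih =>
    intro i
    induction i with
    | zero => simp [gncRatio, coeff_one]
    | succ i ih' =>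
      have h : catalanRat ^ (i + 1) = catalanRat ^ i + X * catalanRat ^ (i + 2) := by
        rw [pow_succ]
        conv_lhs => rw [catalanRat_eq]
        -- The previous rewrite also unfolded the factor `catalanRat ^ i`; this folds it back.
        conv_lhs => enter [1]; rw [← catalanRat_eq]
        ring
      rw [h, map_add, coeff_succ_X_mul, ih', ih, gncRatio_rec]

theorem coeff_pow_of_mul_one_add_X {A : ℚ⟦X⟧} (hA : A * (1 + X) = 1) (m k : ℕ) :
    coeff k (A ^ (m + 1)) = (-1) ^ k * ((m + k).choose k : ℚ) := by
  have h1 := congrArg (rescale (-1 : ℚ)) (mk_add_choose_mul_one_sub_pow_eq_one ℚ m)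
  rw [map_mul, map_pow, map_sub, map_one, rescale_X] at h1
  have h2 : (1 : ℚ⟦X⟧) - C (-1) * X = 1 + X := by simp
  rw [h2] at h1
  have h3 : A ^ (m + 1) = rescale (-1 : ℚ) (mk fun n => ((m + n).choose m : ℚ)) := by
    calc A ^ (m + 1) = A ^ (m + 1) * (rescale (-1 : ℚ) (mk fun n => ((m + n).choose m : ℚ)) *
          (1 + X) ^ (m + 1)) := by rw [h1, mul_one]
      _ = (A * (1 + X)) ^ (m + 1) * rescale (-1 : ℚ) (mk fun n => ((m + n).choose m : ℚ)) := by
          rw [mul_pow]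
          ring
      _ = _ := by rw [hA, one_pow, one_mul]
  rw [h3, coeff_rescale, coeff_mk, Nat.choose_symm_add]

/-- A quadratic equation of this shape has at most one solution among power series. -/
theorem eq_of_quadratic {F G H : ℚ⟦X⟧} (hG : G = 1 + X * (2 * G * F * G - G))
    (hH : H = 1 + X * (2 * H * F * H - H)) : G = H := by
  -- The second factor has constant term 1, so it is not zero.
  have h : (G - H) * (1 - X * (2 * F * (G + H) - 1)) = 0 := by
    linear_combination hG - hH
  rcases mul_eq_zero.1 h with h | h
  · exact sub_eq_zero.1 h
  · have := congrArg constantCoeff h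
    simp at this

/-- The equation reads (1 + X)G = 1 + 2XFG². Putting G = Ac turns it into the Catalan equation c = 1
+ (2XFA²)c². -/
theorem quadratic_solution {A F : ℚ⟦X⟧} (hA : A * (1 + X) = 1) :
    A * catalanRat.subst (2 * X * F * A ^ 2) = 1 + X * (2 * (A * catalanRat.subst
      (2 * X * F * A ^ 2)) * F * (A * catalanRat.subst (2 * X * F * A ^ 2)) -
        A * catalanRat.subst (2 * X * F * A ^ 2)) := by
  have h := catalanRat_subst_eq (a := 2 * X * F * A ^ 2) (by simp)
  linear_combination h + (catalanRat.subst (2 * X * F * A ^ 2)) * hA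

theorem parentSeries_false_eq_subst {A : ℚ⟦X⟧} (hA : A * (1 + X) = 1) :
    parentSeries false = A * catalanRat.subst (2 * X * A ^ 2) := by
  have h := quadratic_solution (F := 1) hA
  rw [mul_one (2 * X : ℚ⟦X⟧)] at h
  refine eq_of_quadratic (F := 1) ?_ h
  rw [mul_one]
  exact parentSeries_false

theorem parentSeries_true_eq_subst {A : ℚ⟦X⟧} (hA : A * (1 + X) = 1) :
    parentSeries true = A * catalanRat.subst (2 * X * parentSeries false * A ^ 2) :=
  eq_of_quadratic parentSeries_true (quadratic_solution hA)

theorem card_parentFns_false (n : ℕ) : #(parentFns false 0 n) = littleSchroder n := by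
  -- Large Schröder numbers are twice the little ones except at 0, so L = 2S - 1; this turns L = 1 +
  -- XL + XL² into the equation for S.
  have h1 : (2 : ℚ⟦X⟧) * mk (fun n => (littleSchroder n : ℚ)) =
      largeSchroderSeries.map (Nat.castRingHom ℚ) + 1 := by
    ext k
    have h2 : (2 : ℚ⟦X⟧) = C (2 : ℚ) := (map_ofNat C 2).symm
    rw [h2, coeff_C_mul, coeff_mk, map_add, coeff_map, coeff_largeSchroderSeries, coeff_one,
      littleSchroder]
    rcases k with _ | k
    · norm_num
    · rw [← Nat.two_mul_smallSchroder_succ k.succ_ne_zero]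
      simp
  have h3 := congrArg (PowerSeries.map (Nat.castRingHom ℚ))
    largeSchroderSeries_eq_one_add_X_mul_largeSchroderSeries_add_X_mul_largeSchroderSeries_sq
  rw [map_add, map_add, map_mul, map_mul, map_pow, map_X, map_one] at h3
  set L := PowerSeries.map (Nat.castRingHom ℚ) largeSchroderSeries
  set S : ℚ⟦X⟧ := mk fun n => (littleSchroder n : ℚ)
  have h4 : S = 1 + X * (2 * S * 1 * S - S) := by
    have h5 : (2 : ℚ⟦X⟧) * (S - (1 + X * (2 * S * 1 * S - S))) = 0 := by
      have hL : L = 2 * S - 1 := by rw [h1]; ring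
      rw [hL] at h3
      linear_combination h3
    rcases mul_eq_zero.1 h5 with h | h
    · exact absurd (congrArg constantCoeff h) (by rw [map_ofNat, map_zero]; norm_num)
    · exact sub_eq_zero.1 h
  have h6 : parentSeries false = S := by
    refine eq_of_quadratic (F := 1) ?_ h4
    rw [mul_one]
    exact parentSeries_false
  have h7 := congrArg (coeff n) h6
  rw [parentSeries, coeff_mk, coeff_mk] at h7
  exact_mod_cast h7

theorem card_parentFns_true (n : ℕ) :
    (#(parentFns true 0 n) : ℚ) = ∑ x ∈ HasAntidiagonal.antidiagonal n,
      ∑ y ∈ HasAntidiagonal.antidiagonal x.2,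
        (-1 : ℚ) ^ y.2 * ((3 * x.1 + 2 * y.1 + y.2).choose y.2 : ℚ) *
          (gncRatio x.1 y.1 * ((2 * y.1 + x.1).choose y.1 : ℚ)) *
          2 ^ (x.1 + y.1) * (catalan x.1 : ℚ) := by
  have hA : ((1 + X : ℚ⟦X⟧)⁻¹) * (1 + X) = 1 := PowerSeries.inv_mul_cancel _ (by simp)
  set A : ℚ⟦X⟧ := (1 + X)⁻¹
  have h1 : (#(parentFns true 0 n) : ℚ) = coeff n (parentSeries true) := by
    rw [parentSeries, coeff_mk]
  have hs := HasSubst.of_constantCoeff_zero' (a := 2 * X * A ^ 2) (S := ℚ) (by simp)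
  have hC : ∀ i : ℕ, (2 : ℚ⟦X⟧) ^ i = C ((2 : ℚ) ^ i) := fun i => by rw [map_pow, map_ofNat]
  rw [h1, parentSeries_true_eq_subst hA, coeff_mul_subst (by simp),
    Nat.sum_antidiagonal_eq_sum_range_succ_mk]
  refine sum_congr rfl fun i hi => ?_
  rw [mem_range] at hi
  -- The exponent `3 * i + 1` collects the outer factor A, `A ^ (2 * i)`, and one A from each of the
  -- `i` factors `parentSeries false`.
  have h2 : A * (2 * X * parentSeries false * A ^ 2) ^ i =
      C ((2 : ℚ) ^ i) * (X ^ i * (A ^ (3 * i + 1) * (catalanRat ^ i).subst (2 * X * A ^ 2))) := by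
    rw [parentSeries_false_eq_subst hA, subst_pow hs, ← hC]
    ring
  rw [h2, coeff_C_mul, coeff_X_pow_mul', if_pos (by omega), coeff_mul_subst (by simp),
    coeff_catalanRat, mul_sum, mul_sum, Nat.sum_antidiagonal_eq_sum_range_succ_mk]
  refine sum_congr rfl fun j hj => ?_
  rw [mem_range] at hj
  have h3 : A ^ (3 * i + 1) * (2 * X * A ^ 2) ^ j =
      C ((2 : ℚ) ^ j) * (X ^ j * A ^ (3 * i + 2 * j + 1)) := by
    rw [← hC]
    ring
  rw [h3, coeff_C_mul, coeff_X_pow_mul', if_pos (by omega), coeff_pow_of_mul_one_add_X hA,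
    coeff_catalanRat_pow]
  ring

end Series

theorem mainTheorem7 (n : ℕ) :
    (GNCTree.avoiding n {[GNCStep.u, GNCStep.d], [GNCStep.h]}).ncard = littleSchroder n ∧
    ((GNCTree.avoiding n {[GNCStep.d, GNCStep.u], [GNCStep.h]}).ncard : ℚ) =
      ∑ x ∈ Finset.HasAntidiagonal.antidiagonal n,
        ∑ y ∈ Finset.HasAntidiagonal.antidiagonal x.2,
          (fun i j k : ℕ =>
            (-1 : ℚ) ^ k * ((3 * i + 2 * j + k).choose k : ℚ) *
              (gncRatio i j * ((2 * j + i).choose j : ℚ)) *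
              2 ^ (i + j) * (catalan i : ℚ)) x.1 y.1 y.2 := by
  rw [GNCTree.ncard_eq_card_parentFns false _ GNCTree.mem_avoiding_ud_h,
    GNCTree.ncard_eq_card_parentFns true _ GNCTree.mem_avoiding_du_h]
  exact ⟨card_parentFns_false n, card_parentFns_true n⟩
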